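/- Let $(\Omega,\mathcal F,\mathbb P)$ be a probability space with a right-continuous filtration $(\mathcal F_t)_{t\ge 0}$ (not necessarily augmented by null sets). For a nonnegative càdlàg local martingale $M=(M_t)_{t\ge0}$ the final value $M_\infty=\lim_{t\to\infty}M_t$ exists in $\mathbb R$ almost surely; put $\overline M_\infty=\sup_{t\ge0}M_t$. Then $M$ can be reconstructed from the pair $(M_\infty,\,X\vee\overline M_\infty)$ for any bounded random variable $X$: there is a map $\Phi$, depending only on the filtered probability space, which assigns to each pair of functions $\xi:\Omega\to\mathbb R$, $\eta:\Omega\to[-\infty,\infty]$ a family $\Phi(\xi,\eta)=(\Phi(\xi,\eta)_t)_{t\ge0}$ of real-valued functions on $\Omega$, such that for every nonnegative càdlàg local martingale $M$, every bounded random variable $X$, and all $\xi,\eta$ with $\xi=M_\infty$ and $\eta=X\vee\overline M_\infty$ almost surely, one has, almost surely, $\Phi(\xi,\eta)_t=M_t$ for all $t\ge0$. In particular, $M$ is determined by its final value together with its global maximum: if $M$ and $N$ are nonnegative càdlàg local martingales with $M_\infty=N_\infty$ and $\overline M_\infty=\overline N_\infty$ almost surely, then almost surely $M_t=N_t$ for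 all $t\ge0$. -/

import Mathlib

open MeasureTheory ProbabilityTheory Filter Topology
open scoped NNReal

/-- Every path is right-continuous with finite left limits. -/
def HasCadlagPaths {Ω : Type*} (M : ℝ≥0 → Ω → ℝ) : Prop :=
  ∀ ω t, ContinuousWithinAt (fun s ↦ M s ω) (Set.Ici t) t ∧
    ∃ l : ℝ, Tendsto (fun s ↦ M s ω) (𝓝[<] t) (𝓝 l)

/-- A local martingale in continuous time: an adapted càdlàg process `M` with stopping times
`τ n ↑ ∞` almost surely such that each `1_{τ n > 0} M^{τ n}` is a martingale.
The initial value `M 0` need not be integrable. -/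
structure IsLocalMartingale {Ω : Type*} {mΩ : MeasurableSpace Ω} (M : ℝ≥0 → Ω → ℝ)
    (𝓕 : Filtration ℝ≥0 mΩ) (P : Measure Ω) : Prop where
  adapted : StronglyAdapted 𝓕 M
  cadlag : HasCadlagPaths M
  locally_martingale : Locally (fun Y ↦ Martingale Y 𝓕 P) 𝓕 M P

/-- The final value `M_∞ = lim_{t → ∞} M_t` (arbitrary where the limit does not exist). -/
noncomputable def finalValue {Ω : Type*} (M : ℝ≥0 → Ω → ℝ) (ω : Ω) : ℝ :=
  limUnder atTop (fun t ↦ M t ω)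

/-- The global maximum `sup_{t ≥ 0} M_t`, as an extended real number. -/
noncomputable def globalMax {Ω : Type*} (M : ℝ≥0 → Ω → ℝ) (ω : Ω) : EReal :=
  ⨆ t : ℝ≥0, (M t ω : EReal)

/-- The nonnegative local martingales, nonnegativity being understood almost surely. -/
structure IsNonnegLocalMartingale {Ω : Type*} {mΩ : MeasurableSpace Ω} (M : ℝ≥0 → Ω → ℝ)
    (𝓕 : Filtration ℝ≥0 mΩ) (P : Measure Ω) : Prop extends IsLocalMartingale M 𝓕 P where
  nonneg : ∀ᵐ ω ∂P, ∀ t, 0 ≤ M t ω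

/-! Uniqueness is the whole matter: once two nonnegative local martingales M, N with the same data
are shown indistinguishable, the map can pick any compatible process. Since X is bounded, the data
tell, for every level K above some constant, whether the path ever exceeds K. Let σ_K be the first
time at which M or N exceeds K.

If M exceeds K first, then N is at most K at that moment but must still exceed K later. As N is a
supermartingale, it cannot rise on average, so it equals K there (`ae_le_stoppedValue_hitTime`).
Hence both processes are at least K at σ_K. A level q strictly between their values at σ_K would be
exceeded by one of them at that very time, so the same argument at level q puts both at q or above,
a contradiction. Thus M = N at σ_K, even if the paths jump (`ae_stoppedValue_eq`).

Before σ_K both lie in [0, K]. So M - N up to σ_K is a bounded martingale with terminal value 0, by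
the above if σ_K is finite and by equality of the final values otherwise; it vanishes
(`ae_eq_of_lt`). Almost every path is bounded, so σ_K is infinite for large K. -/

section

variable {Ω : Type*} {mΩ : MeasurableSpace Ω} {P : Measure Ω} {𝓕 : Filtration ℝ≥0 mΩ}

/-! ### Optional sampling in continuous time -/

/-- A bounded stopping time is a limit from the right of bounded stopping times with countable
range. -/
theorem exists_stoppingTime_countable_range {σ : Ω → WithTop ℝ≥0} (hσ : IsStoppingTime 𝓕 σ)
    {T : ℝ≥0} (hσT : ∀ ω, σ ω ≤ T) :
    ∃ ρ : ℕ → Ω → WithTop ℝ≥0, (∀ n, IsStoppingTime 𝓕 (ρ n)) ∧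
      (∀ n, (Set.range (ρ n)).Countable) ∧ (∀ n, σ ≤ ρ n) ∧ (∀ n ω, ρ n ω ≤ T) ∧
      ∀ ω, Tendsto (fun n ↦ (ρ n ω).untopA) atTop (𝓝[≥] (σ ω).untopA) := by
  have hcoe : ∀ ω, ((σ ω).untopA : WithTop ℝ≥0) = σ ω := fun ω ↦ by
    have h : σ ω ≠ ⊤ := ne_top_of_le_ne_top WithTop.coe_ne_top (hσT ω)
    rw [WithTop.untopA_eq_untop h, WithTop.coe_untop]
  let x : Ω → ℝ≥0 := fun ω ↦ (σ ω).untopA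
  have hxT : ∀ ω, x ω ≤ T := fun ω ↦ by
    have := hσT ω
    rw [← hcoe] at this
    exact_mod_cast this
  let c : ℕ → ℕ → ℝ≥0 := fun n j ↦ min T ((j + 1 : ℝ≥0) / (n + 1))
  let r : ℕ → Ω → ℝ≥0 := fun n ω ↦ c n ⌊(n + 1 : ℝ≥0) * x ω⌋₊
  have hpos : ∀ n : ℕ, (0 : ℝ≥0) < n + 1 := fun n ↦ by positivity
  have hxr : ∀ n ω, x ω ≤ r n ω := fun n ω ↦ by
    refine le_min (hxT ω) ?_
    rw [le_div_iff₀ (hpos n), mul_comm]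
    exact (Nat.lt_floor_add_one _).le
  have hrx : ∀ n ω, r n ω ≤ x ω + 1 / (n + 1) := fun n ω ↦ by
    refine (min_le_right _ _).trans ?_
    rw [div_le_iff₀ (hpos n), add_mul (x ω), div_mul_cancel₀ _ (hpos n).ne', mul_comm (x ω)]
    gcongr
    exact Nat.floor_le zero_le
  refine ⟨fun n ω ↦ (r n ω : WithTop ℝ≥0), fun n i ↦ ?_, fun n ↦ ?_, fun n ω ↦ ?_,
    fun n ω ↦ ?_, fun ω ↦ ?_⟩
  · by_cases hTi : T ≤ i
    · have : {ω | (r n ω : WithTop ℝ≥0) ≤ i} = Set.univ := by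
        ext ω
        simp only [Set.mem_ofPred_eq, Set.mem_univ, iff_true, WithTop.coe_le_coe]
        exact (min_le_left _ _).trans hTi
      rw [this]
      exact MeasurableSet.univ
    · let j : ℝ≥0 := (⌊i * (n + 1 : ℝ≥0)⌋₊ : ℝ≥0) / (n + 1)
      have hji : j ≤ i := by
        rw [div_le_iff₀ (hpos n)]
        exact Nat.floor_le zero_le
      have : {ω | (r n ω : WithTop ℝ≥0) ≤ i} = {ω | σ ω < j} := by
        ext ω
        simp only [Set.mem_ofPred_eq, WithTop.coe_le_coe]
        rw [← hcoe, WithTop.coe_lt_coe]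
        change min T _ ≤ i ↔ x ω < j
        rw [min_le_iff, or_iff_right hTi, div_le_iff₀ (hpos n), lt_div_iff₀ (hpos n),
          mul_comm (x ω), ← Nat.floor_lt zero_le, ← Nat.succ_le_iff,
          Nat.le_floor_iff zero_le]
        push_cast
        rfl
      rw [this]
      exact 𝓕.mono hji _ (hσ.measurableSet_lt j)
  · refine (Set.countable_range fun j : ℕ ↦ (c n j : WithTop ℝ≥0)).mono ?_
    rintro _ ⟨ω, rfl⟩
    exact ⟨_, rfl⟩
  · rw [← hcoe]
    exact WithTop.coe_le_coe.2 (hxr n ω)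
  · exact WithTop.coe_le_coe.2 (min_le_left _ _)
  · change Tendsto (fun n ↦ r n ω) atTop (𝓝[≥] (x ω))
    refine tendsto_nhdsWithin_iff.2 ⟨?_, Eventually.of_forall fun n ↦ hxr n ω⟩
    refine tendsto_of_tendsto_of_tendsto_of_le_of_le tendsto_const_nhds ?_
      (fun n ↦ hxr n ω) (fun n ↦ hrx n ω)
    have h : Tendsto (fun n : ℕ ↦ (1 : ℝ≥0) / (n + 1)) atTop (𝓝 0) :=
      tendsto_one_div_add_atTop_nhds_zero_nat
    simpa using h.const_add (x ω)

/-- Optional sampling for a right-continuous martingale at a bounded stopping time. -/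
theorem MeasureTheory.Martingale.optional_sampling [IsFiniteMeasure P] {Y : ℝ≥0 → Ω → ℝ}
    (hY : Martingale Y 𝓕 P)
    (hrc : ∀ ω t, ContinuousWithinAt (fun s ↦ Y s ω) (Set.Ici t) t)
    {σ : Ω → WithTop ℝ≥0} (hσ : IsStoppingTime 𝓕 σ) {T : ℝ≥0} (hσT : ∀ ω, σ ω ≤ T) :
    Integrable (stoppedValue Y σ) P ∧
      ∀ F, MeasurableSet[hσ.measurableSpace] F →
        ∫ ω in F, stoppedValue Y σ ω ∂P = ∫ ω in F, Y T ω ∂P := by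
  obtain ⟨ρ, hρ, hρc, hσρ, hρT, hlim⟩ := exists_stoppingTime_countable_range hσ hσT
  have hcond : ∀ n, stoppedValue Y (ρ n) =ᵐ[P] P[Y T | (hρ n).measurableSpace] := fun n ↦
    hY.stoppedValue_ae_eq_condExp_of_le_const_of_countable_range (hρ n) (hρT n) (hρc n)
  -- Uniform integrability turns the pathwise limit given by right-continuity into an L¹ limit, so
  -- integrals over `F` converge.
  have hUI : UniformIntegrable (fun n ↦ P[Y T | (hρ n).measurableSpace]) 1 P :=
    (hY.integrable T).uniformIntegrable_condExp fun n ↦ (hρ n).measurableSpace_le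
  have htend : ∀ᵐ ω ∂P, Tendsto (fun n ↦ (P[Y T | (hρ n).measurableSpace]) ω) atTop
      (𝓝 (stoppedValue Y σ ω)) := by
    filter_upwards [ae_all_iff.2 hcond] with ω hω
    simp_rw [← hω]
    exact (hrc ω _).tendsto.comp (hlim ω)
  have hint : MemLp (stoppedValue Y σ) 1 P := hUI.memLp_of_ae_tendsto htend
  have hL1 := tendsto_Lp_finite_of_tendsto_ae le_rfl ENNReal.one_ne_top hUI.1 hint hUI.2.1 htend
  refine ⟨memLp_one_iff_integrable.1 hint, fun F hF ↦ ?_⟩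
  have hFm : ∀ n, MeasurableSet[(hρ n).measurableSpace] F := fun n ↦
    hσ.measurableSpace_mono (hρ n) (hσρ n) _ hF
  have h1 : Tendsto (fun n ↦ ∫ ω in F, (P[Y T | (hρ n).measurableSpace]) ω ∂P) atTop
      (𝓝 (∫ ω in F, stoppedValue Y σ ω ∂P)) :=
    tendsto_setIntegral_of_L1' _ hint.1
      (Eventually.of_forall fun n ↦ integrable_condExp) hL1 F
  refine tendsto_nhds_unique h1 ?_
  have h2 : ∀ n, ∫ ω in F, (P[Y T | (hρ n).measurableSpace]) ω ∂P = ∫ ω in F, Y T ω ∂P :=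
    fun n ↦ setIntegral_condExp (hρ n).measurableSpace_le (hY.integrable T) (hFm n)
  simp_rw [h2]
  exact tendsto_const_nhds

/-- Stopping a right-continuous process preserves right-continuity. -/
theorem continuousWithinAt_stoppedProcess {M : ℝ≥0 → Ω → ℝ}
    (hrc : ∀ ω t, ContinuousWithinAt (fun s ↦ M s ω) (Set.Ici t) t) (ρ : Ω → WithTop ℝ≥0)
    (ω : Ω) (t : ℝ≥0) :
    ContinuousWithinAt (fun s ↦ stoppedProcess M ρ s ω) (Set.Ici t) t := by
  cases h : ρ ω with
  | top =>
    have htop : ∀ s : ℝ≥0, stoppedProcess M ρ s ω = M s ω := fun s ↦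
      stoppedProcess_eq_of_le (by rw [h]; exact le_top)
    simpa only [htop] using hrc ω t
  | coe r =>
    have hmin : ∀ s : ℝ≥0, stoppedProcess M ρ s ω = M (min s r) ω := fun s ↦ by
      rw [stoppedProcess, h, ← WithTop.coe_min]
      rfl
    simp_rw [hmin]
    refine ContinuousWithinAt.comp (t := Set.Ici (min t r)) (f := fun s : ℝ≥0 ↦ min s r)
      (g := fun s ↦ M s ω) (hrc ω _) (by fun_prop) fun s hs ↦ ?_
    exact min_le_min_right r hs

/-- Optional sampling for a process reduced by `ρ` to a martingale. -/
theorem setIntegral_stoppedValue_of_reduced [IsFiniteMeasure P] {M : ℝ≥0 → Ω → ℝ}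
    (hrc : ∀ ω t, ContinuousWithinAt (fun s ↦ M s ω) (Set.Ici t) t) {ρ : Ω → WithTop ℝ≥0}
    (hM : Martingale (stoppedProcess (fun i ↦ {ω | ⊥ < ρ ω}.indicator (M i)) ρ) 𝓕 P)
    {σ τ : Ω → WithTop ℝ≥0} (hσ : IsStoppingTime 𝓕 σ) (hτ : IsStoppingTime 𝓕 τ) (hστ : σ ≤ τ)
    {T : ℝ≥0} (hτT : ∀ ω, τ ω ≤ T) {F : Set Ω} (hF : MeasurableSet[hσ.measurableSpace] F)
    (hFρ : ∀ ω ∈ F, ⊥ < ρ ω) :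
    IntegrableOn (stoppedValue M (fun ω ↦ min (σ ω) (ρ ω))) F P ∧
      IntegrableOn (stoppedValue M (fun ω ↦ min (τ ω) (ρ ω))) F P ∧
      ∫ ω in F, stoppedValue M (fun ω ↦ min (σ ω) (ρ ω)) ω ∂P =
        ∫ ω in F, stoppedValue M (fun ω ↦ min (τ ω) (ρ ω)) ω ∂P := by
  set Y := stoppedProcess (fun i ↦ {ω | ⊥ < ρ ω}.indicator (M i)) ρ with hYdef
  have hYrc : ∀ ω t, ContinuousWithinAt (fun s ↦ Y s ω) (Set.Ici t) t := by
    refine fun ω t ↦ continuousWithinAt_stoppedProcess (fun ω t ↦ ?_) ρ ω t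
    by_cases h : ω ∈ {ω | ⊥ < ρ ω}
    · simpa only [Set.indicator_of_mem h] using hrc ω t
    · simpa only [Set.indicator_of_notMem h] using continuousWithinAt_const
  have hσT : ∀ ω, σ ω ≤ T := fun ω ↦ (hστ ω).trans (hτT ω)
  have hFm : MeasurableSet F := hσ.measurableSpace_le _ hF
  have hval : ∀ θ : Ω → WithTop ℝ≥0, (∀ ω, θ ω ≤ T) →
      Set.EqOn (stoppedValue Y θ) (stoppedValue M (fun ω ↦ min (θ ω) (ρ ω))) F := by
    intro θ hθ ω hω
    rw [hYdef, stoppedValue_stoppedProcess_apply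
      (ne_top_of_le_ne_top WithTop.coe_ne_top (hθ ω))]
    exact Set.indicator_of_mem (s := {ω | ⊥ < ρ ω}) (hFρ ω hω) _
  obtain ⟨hi1, he1⟩ := hM.optional_sampling hYrc hσ hσT
  obtain ⟨hi2, he2⟩ := hM.optional_sampling hYrc hτ hτT
  refine ⟨hi1.integrableOn.congr_fun (hval σ hσT) hFm, hi2.integrableOn.congr_fun (hval τ hτT) hFm,
    ?_⟩
  rw [← setIntegral_congr_fun hFm (hval σ hσT), ← setIntegral_congr_fun hFm (hval τ hτT),
    he1 F hF, he2 F (hσ.measurableSpace_mono hτ hστ _ hF)]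

theorem eventually_lt_of_tendsto_top {u : ℕ → WithTop ℝ≥0} (hu : Tendsto u atTop (𝓝 ⊤))
    (t : ℝ≥0) : ∀ᶠ n in atTop, (t : WithTop ℝ≥0) < u n :=
  hu.eventually_const_lt (WithTop.coe_lt_top t)

/-- Optional sampling inequality for nonnegative local martingales and arbitrary stopping times. -/
theorem IsNonnegLocalMartingale.setLIntegral_stoppedValue_le [IsFiniteMeasure P]
    {M : ℝ≥0 → Ω → ℝ} (hM : IsNonnegLocalMartingale M 𝓕 P) {σ τ : Ω → WithTop ℝ≥0}
    (hσ : IsStoppingTime 𝓕 σ) (hτ : IsStoppingTime 𝓕 τ) (hστ : σ ≤ τ) {F : Set Ω}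
    (hF : MeasurableSet[hσ.measurableSpace] F) :
    ∫⁻ ω in F ∩ {ω | τ ω < ⊤}, ENNReal.ofReal (stoppedValue M τ ω) ∂P ≤
      ∫⁻ ω in F ∩ {ω | σ ω < ⊤}, ENNReal.ofReal (stoppedValue M σ ω) ∂P := by
  obtain ⟨ρ, hρ, hmart⟩ := hM.locally_martingale
  have hrc := fun ω t ↦ (hM.cadlag ω t).1
  have hFm : MeasurableSet F := hσ.measurableSpace_le _ hF
  -- Where the `n`-th localization is still running at `σ`: there the reduced process at `σ` is `M`
  -- itself, and `ρ n > 0` makes the indicator harmless. The bound `σ ≤ n` puts the set in the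
  -- σ-algebra at `min σ n`.
  let G : ℕ → Set Ω := fun n ↦ F ∩ {ω | ρ n ω ≤ σ ω}ᶜ ∩ {ω | σ ω ≤ (n : ℝ≥0)}
  have hG1 : ∀ n : ℕ, MeasurableSet[(hσ.min_const (n : ℝ≥0)).measurableSpace] (G n) := fun n ↦ by
    have h1 : MeasurableSet[hσ.measurableSpace] (F ∩ {ω | ρ n ω ≤ σ ω}ᶜ) :=
      hF.inter ((hρ.isStoppingTime n).measurableSet_stopping_time_le hσ).compl
    exact (hσ.measurableSet_inter_le_const_iff _ _).1 (h1.inter (hσ.measurableSet_le' _))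
  have hG : ∀ n, MeasurableSet (G n) := fun n ↦
    (hσ.min_const (n : ℝ≥0)).measurableSpace_le _ (hG1 n)
  have hGρ : ∀ n, ∀ ω ∈ G n, σ ω < ρ n ω := fun n ω hω ↦ not_le.1 hω.1.2
  let g : ℕ → Ω → ℝ := fun n ↦ stoppedValue M (fun ω ↦ min (min (τ ω) (n : ℝ≥0)) (ρ n ω))
  have key := fun n ↦ setIntegral_stoppedValue_of_reduced hrc (hmart n)
    (hσ.min_const (n : ℝ≥0)) (hτ.min_const (n : ℝ≥0))
    (fun ω ↦ min_le_min_right _ (hστ ω)) (fun ω ↦ min_le_right _ _) (hG1 n)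
    (fun ω hω ↦ bot_le.trans_lt (hGρ n ω hω))
  have hnn : ∀ θ : Ω → WithTop ℝ≥0, ∀ s, 0 ≤ᵐ[P.restrict s] stoppedValue M θ := fun θ s ↦
    ae_restrict_of_ae (by filter_upwards [hM.nonneg] with ω hω using hω _)
  have hle : ∀ n, ∫⁻ ω in G n, ENNReal.ofReal (g n ω) ∂P ≤
      ∫⁻ ω in F ∩ {ω | σ ω < ⊤}, ENNReal.ofReal (stoppedValue M σ ω) ∂P := fun n ↦ by
    obtain ⟨hi1, hi2, he⟩ := key n
    rw [← ofReal_integral_eq_lintegral_ofReal hi2 (hnn _ _), ← he,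
      ofReal_integral_eq_lintegral_ofReal hi1 (hnn _ _)]
    calc _ = ∫⁻ ω in G n, ENNReal.ofReal (stoppedValue M σ ω) ∂P := by
          refine setLIntegral_congr_fun (hG n) fun ω hω ↦ ?_
          have hσn : σ ω ≤ (n : ℝ≥0) := hω.2
          have h1 : min (min (σ ω) (n : ℝ≥0)) (ρ n ω) = σ ω := by
            rw [min_eq_left hσn, min_eq_left (hGρ n ω hω).le]
          simp only [stoppedValue, h1]
      _ ≤ _ := by
          refine lintegral_mono_set fun ω hω ↦ ⟨hω.1.1, ?_⟩
          have hσn : σ ω ≤ (n : ℝ≥0) := hω.2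
          exact hσn.trans_lt (WithTop.coe_lt_top _)
  have hτm : MeasurableSet {ω | τ ω < ⊤} := measurableSet_lt hτ.measurable' measurable_const
  rw [← lintegral_indicator (hFm.inter hτm)]
  -- Fatou: where `τ` is finite, the localized value at `τ` is eventually `M` at `τ`.
  calc _ ≤ ∫⁻ ω, liminf (fun n ↦ (G n).indicator (fun ω ↦ ENNReal.ofReal (g n ω)) ω) atTop ∂P := by
        refine lintegral_mono_ae ?_
        filter_upwards [hρ.tendsto_top] with ω hω
        refine Set.indicator_apply_le' (fun hωF ↦ ?_) fun _ ↦ zero_le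
        have hτω : τ ω < ⊤ := hωF.2
        obtain ⟨t, ht⟩ := WithTop.ne_top_iff_exists.1 hτω.ne
        refine le_liminf_of_le (by isBoundedDefault) ?_
        filter_upwards [eventually_lt_of_tendsto_top hω t,
          (tendsto_natCast_atTop_atTop (R := ℝ≥0)).eventually_ge_atTop t] with n hn1 hn2
        have hσt : σ ω ≤ t := by rw [ht]; exact hστ ω
        have hωG : ω ∈ G n := ⟨⟨hωF.1, not_le.2 (hσt.trans_lt hn1)⟩,
          hσt.trans (WithTop.coe_le_coe.2 hn2)⟩
        have h1 : min (min (τ ω) (n : ℝ≥0)) (ρ n ω) = τ ω := by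
          rw [← ht, min_eq_left (WithTop.coe_le_coe.2 hn2), min_eq_left hn1.le]
        rw [Set.indicator_of_mem hωG]
        simp only [g, stoppedValue, h1, le_refl]
    _ ≤ liminf (fun n ↦ ∫⁻ ω, (G n).indicator (fun ω ↦ ENNReal.ofReal (g n ω)) ω ∂P) atTop :=
        lintegral_liminf_le' fun n ↦ (aemeasurable_indicator_iff (hG n)).2
          (key n).2.1.aestronglyMeasurable.aemeasurable.ennreal_ofReal
    _ ≤ _ := by
        refine liminf_le_of_le (by isBoundedDefault) fun b hb ↦ ?_
        obtain ⟨n, hn⟩ := hb.exists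
        rw [lintegral_indicator (hG n)] at hn
        exact hn.trans (hle n)

/-! ### First passage times -/

/-- The first time after `σ` at which the path of `M` is in `S`. -/
noncomputable def hitTime (M : ℝ≥0 → Ω → ℝ) (σ : Ω → WithTop ℝ≥0) (S : Set ℝ) (ω : Ω) :
    WithTop ℝ≥0 :=
  ⨅ (t : ℝ≥0) (_ : σ ω ≤ t ∧ M t ω ∈ S), (t : WithTop ℝ≥0)

section hitTime

variable {M : ℝ≥0 → Ω → ℝ} {σ : Ω → WithTop ℝ≥0} {S : Set ℝ} {ω : Ω}

theorem hitTime_lt_iff {b : WithTop ℝ≥0} :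
    hitTime M σ S ω < b ↔ ∃ t : ℝ≥0, σ ω ≤ t ∧ M t ω ∈ S ∧ (t : WithTop ℝ≥0) < b := by
  simp only [hitTime, iInf_lt_iff, exists_prop, and_assoc]

theorem hitTime_le_of_mem {t : ℝ≥0} (h : σ ω ≤ t) (hS : M t ω ∈ S) : hitTime M σ S ω ≤ t :=
  iInf₂_le t ⟨h, hS⟩

theorem le_hitTime : σ ≤ hitTime M σ S := fun _ ↦ le_iInf₂ fun _ h ↦ h.1

theorem notMem_of_lt_hitTime {t : ℝ≥0} (h : σ ω ≤ t) (ht : t < hitTime M σ S ω) : M t ω ∉ S :=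
  fun hS ↦ (hitTime_le_of_mem h hS).not_gt ht

theorem hitTime_anti {S' : Set ℝ} (h : S ⊆ S') : hitTime M σ S' ≤ hitTime M σ S :=
  fun _ ↦ le_iInf₂ fun _ ht ↦ hitTime_le_of_mem ht.1 (h ht.2)

theorem hitTime_lt_top_of_frequently (hσ : σ ω < ⊤) (h : ∃ᶠ t in atTop, M t ω ∈ S) :
    hitTime M σ S ω < ⊤ := by
  obtain ⟨s, hs⟩ := WithTop.ne_top_iff_exists.1 hσ.ne
  obtain ⟨t, hst, ht⟩ := frequently_atTop.1 h s
  exact hitTime_lt_iff.2 ⟨t, hs ▸ WithTop.coe_le_coe.2 hst, ht, WithTop.coe_lt_top t⟩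

/-- The infimum need not be attained, but it is approached from the right by times at which the path
is in `S`. -/
theorem stoppedValue_hitTime_mem_closure
    (hrc : ∀ ω t, ContinuousWithinAt (fun s ↦ M s ω) (Set.Ici t) t)
    (h : hitTime M σ S ω < ⊤) : stoppedValue M (hitTime M σ S) ω ∈ closure S := by
  obtain ⟨t, ht⟩ := WithTop.ne_top_iff_exists.1 h.ne
  have hval : stoppedValue M (hitTime M σ S) ω = M t ω := by
    simp only [stoppedValue, ← ht]; rfl
  rw [hval]
  refine mem_closure_of_frequently_of_tendsto ?_ (hrc ω t).tendsto
  refine (nhdsGE_basis t).frequently_iff.2 fun b hb ↦ ?_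
  have : hitTime M σ S ω < b := by rw [← ht]; exact WithTop.coe_lt_coe.2 hb
  obtain ⟨s, hσs, hs, hsb⟩ := hitTime_lt_iff.1 this
  refine ⟨s, ⟨?_, WithTop.coe_lt_coe.1 hsb⟩, hs⟩
  have := hitTime_le_of_mem hσs hs
  rw [← ht] at this
  exact WithTop.coe_le_coe.1 this

theorem le_stoppedValue_hitTime_Ioi {b : ℝ}
    (hrc : ∀ ω t, ContinuousWithinAt (fun s ↦ M s ω) (Set.Ici t) t)
    (h : hitTime M σ (Set.Ioi b) ω < ⊤) : b ≤ stoppedValue M (hitTime M σ (Set.Ioi b)) ω := by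
  simpa using stoppedValue_hitTime_mem_closure hrc h

theorem stoppedValue_hitTime_Iio_le {a : ℝ}
    (hrc : ∀ ω t, ContinuousWithinAt (fun s ↦ M s ω) (Set.Ici t) t)
    (h : hitTime M σ (Set.Iio a) ω < ⊤) : stoppedValue M (hitTime M σ (Set.Iio a)) ω ≤ a := by
  simpa using stoppedValue_hitTime_mem_closure hrc h

/-- By right-continuity a visit to an open set lasts for a while, so it is seen at a later time of a
countable dense set. Right-continuity of the filtration makes the strict inequality sufficient. -/
theorem isStoppingTime_hitTime [𝓕.IsRightContinuous] (hM : StronglyAdapted 𝓕 M)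
    (hrc : ∀ ω t, ContinuousWithinAt (fun s ↦ M s ω) (Set.Ici t) t) (hσ : IsStoppingTime 𝓕 σ)
    (hS : IsOpen S) : IsStoppingTime 𝓕 (hitTime M σ S) := by
  refine isStoppingTime_of_measurableSet_lt_of_isRightContinuous fun i ↦ ?_
  let d := TopologicalSpace.denseSeq ℝ≥0
  have heq : {ω | hitTime M σ S ω < i} =
      ⋃ (n : ℕ) (_ : d n < i), {ω | σ ω < d n} ∩ (M (d n)) ⁻¹' S := by
    ext ω
    simp only [Set.mem_ofPred_eq, Set.mem_iUnion, Set.mem_inter_iff, Set.mem_preimage,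
      exists_prop, hitTime_lt_iff]
    constructor
    · rintro ⟨t, hσt, htS, hti⟩
      have hev : ∀ᶠ s in 𝓝[>] t, M s ω ∈ S :=
        ((hrc ω t).mono Set.Ioi_subset_Ici_self).eventually_mem (hS.mem_nhds htS)
      obtain ⟨u, hu, hsub⟩ := (mem_nhdsGT_iff_exists_Ioo_subset).1 hev
      have htu : t < min u i := lt_min hu (WithTop.coe_lt_coe.1 hti)
      obtain ⟨n, hq⟩ := (TopologicalSpace.denseRange_denseSeq ℝ≥0).exists_mem_open
        isOpen_Ioo (Set.nonempty_Ioo.2 htu)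
      exact ⟨n, hq.2.trans_le (min_le_right _ _), hσt.trans_lt (WithTop.coe_lt_coe.2 hq.1),
        hsub ⟨hq.1, hq.2.trans_le (min_le_left _ _)⟩⟩
    · rintro ⟨n, hni, hσn, hnS⟩
      exact ⟨d n, hσn.le, hnS, WithTop.coe_lt_coe.2 hni⟩
  rw [heq]
  refine MeasurableSet.iUnion fun n ↦ MeasurableSet.iUnion fun hn ↦ 𝓕.mono hn.le _ ?_
  exact (hσ.measurableSet_lt _).inter ((hM (d n)).measurable hS.measurableSet)

end hitTime

/-! ### Upcrossings, convergence and boundedness of paths -/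

/-- Between two stopping times, a nonnegative local martingale that starts below `a` ends
above `b` with conditional probability at most `a / b`. -/
theorem IsNonnegLocalMartingale.mul_measure_le [IsFiniteMeasure P]
    {M : ℝ≥0 → Ω → ℝ} (hM : IsNonnegLocalMartingale M 𝓕 P) {σ τ : Ω → WithTop ℝ≥0}
    (hσ : IsStoppingTime 𝓕 σ) (hτ : IsStoppingTime 𝓕 τ) (hστ : σ ≤ τ) {F : Set Ω}
    (hF : MeasurableSet[hσ.measurableSpace] F) {a b : ℝ}
    (ha : ∀ ω ∈ F, σ ω < ⊤ → stoppedValue M σ ω ≤ a)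
    (hb : ∀ ω ∈ F, τ ω < ⊤ → b ≤ stoppedValue M τ ω) :
    ENNReal.ofReal b * P (F ∩ {ω | τ ω < ⊤}) ≤ ENNReal.ofReal a * P (F ∩ {ω | σ ω < ⊤}) := by
  have hFm : MeasurableSet F := hσ.measurableSpace_le _ hF
  have hτm : MeasurableSet {ω | τ ω < ⊤} := measurableSet_lt hτ.measurable' measurable_const
  have hσm : MeasurableSet {ω | σ ω < ⊤} := measurableSet_lt hσ.measurable' measurable_const
  calc _ = ∫⁻ _ in F ∩ {ω | τ ω < ⊤}, ENNReal.ofReal b ∂P := (setLIntegral_const _ _).symm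
    _ ≤ ∫⁻ ω in F ∩ {ω | τ ω < ⊤}, ENNReal.ofReal (stoppedValue M τ ω) ∂P :=
        setLIntegral_mono' (hFm.inter hτm) fun ω hω ↦ ENNReal.ofReal_le_ofReal (hb ω hω.1 hω.2)
    _ ≤ ∫⁻ ω in F ∩ {ω | σ ω < ⊤}, ENNReal.ofReal (stoppedValue M σ ω) ∂P :=
        hM.setLIntegral_stoppedValue_le hσ hτ hστ hF
    _ ≤ ∫⁻ _ in F ∩ {ω | σ ω < ⊤}, ENNReal.ofReal a ∂P :=
        setLIntegral_mono' (hFm.inter hσm) fun ω hω ↦ ENNReal.ofReal_le_ofReal (ha ω hω.1 hω.2)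
    _ = _ := setLIntegral_const _ _

/-- The time at which `M` completes its `k`-th upcrossing of `[a, b]`, counting a first passage
above `b` as the zeroth. -/
noncomputable def upcrossTime (M : ℝ≥0 → Ω → ℝ) (a b : ℝ) : ℕ → Ω → WithTop ℝ≥0
  | 0 => hitTime M (fun _ ↦ 0) (Set.Ioi b)
  | k + 1 => hitTime M (hitTime M (upcrossTime M a b k) (Set.Iio a)) (Set.Ioi b)

theorem isStoppingTime_upcrossTime [𝓕.IsRightContinuous] {M : ℝ≥0 → Ω → ℝ}
    (hM : StronglyAdapted 𝓕 M)
    (hrc : ∀ ω t, ContinuousWithinAt (fun s ↦ M s ω) (Set.Ici t) t) (a b : ℝ) (k : ℕ) :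
    IsStoppingTime 𝓕 (upcrossTime M a b k) := by
  induction k with
  | zero => exact isStoppingTime_hitTime hM hrc (isStoppingTime_const 𝓕 0) isOpen_Ioi
  | succ k ih =>
    exact isStoppingTime_hitTime hM hrc (isStoppingTime_hitTime hM hrc ih isOpen_Iio) isOpen_Ioi

theorem upcrossTime_lt_top_of_frequently {M : ℝ≥0 → Ω → ℝ} {a b : ℝ} {ω : Ω}
    (ha : ∃ᶠ t in atTop, M t ω < a) (hb : ∃ᶠ t in atTop, b < M t ω) (k : ℕ) :
    upcrossTime M a b k ω < ⊤ := by
  induction k with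
  | zero => exact hitTime_lt_top_of_frequently (WithTop.coe_lt_top 0) hb
  | succ k ih => exact hitTime_lt_top_of_frequently (hitTime_lt_top_of_frequently ih ha) hb

/-- Each return from below `a` to above `b` costs a factor `a / b`. -/
theorem IsNonnegLocalMartingale.measure_upcrossTime_le [IsProbabilityMeasure P]
    [𝓕.IsRightContinuous] {M : ℝ≥0 → Ω → ℝ} (hM : IsNonnegLocalMartingale M 𝓕 P) {a b : ℝ}
    (hb : 0 < b) (k : ℕ) :
    P {ω | upcrossTime M a b k ω < ⊤} ≤ (ENNReal.ofReal a / ENNReal.ofReal b) ^ k := by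
  have hrc := fun ω t ↦ (hM.cadlag ω t).1
  induction k with
  | zero => simpa using prob_le_one
  | succ k ih =>
    have hs := isStoppingTime_upcrossTime hM.adapted hrc a b k
    have hd := isStoppingTime_hitTime hM.adapted hrc hs (isOpen_Iio (a := a))
    have hu := isStoppingTime_hitTime hM.adapted hrc hd (isOpen_Ioi (a := b))
    have h1 := hM.mul_measure_le hd hu le_hitTime MeasurableSet.univ (a := a) (b := b)
      (fun ω _ h ↦ stoppedValue_hitTime_Iio_le hrc h)
      (fun ω _ h ↦ le_stoppedValue_hitTime_Ioi hrc h)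
    simp only [Set.univ_inter] at h1
    have hb0 : ENNReal.ofReal b ≠ 0 := by simpa using hb
    have h2 : P {ω | hitTime M (upcrossTime M a b k) (Set.Iio a) ω < ⊤} ≤
        P {ω | upcrossTime M a b k ω < ⊤} :=
      measure_mono fun ω hω ↦ (le_hitTime ω).trans_lt hω
    calc P {ω | upcrossTime M a b (k + 1) ω < ⊤}
        ≤ ENNReal.ofReal a * P {ω | hitTime M (upcrossTime M a b k) (Set.Iio a) ω < ⊤} /
            ENNReal.ofReal b := by
          rw [ENNReal.le_div_iff_mul_le (Or.inl hb0) (Or.inl ENNReal.ofReal_ne_top), mul_comm]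
          exact h1
      _ ≤ ENNReal.ofReal a * (ENNReal.ofReal a / ENNReal.ofReal b) ^ k / ENNReal.ofReal b := by
          gcongr
          exact h2.trans ih
      _ = _ := by rw [pow_succ', ENNReal.mul_div_right_comm]

theorem IsNonnegLocalMartingale.ae_not_frequently [IsProbabilityMeasure P]
    [𝓕.IsRightContinuous] {M : ℝ≥0 → Ω → ℝ} (hM : IsNonnegLocalMartingale M 𝓕 P) {a b : ℝ}
    (hab : a < b) :
    ∀ᵐ ω ∂P, ¬((∃ᶠ t in atTop, M t ω < a) ∧ ∃ᶠ t in atTop, b < M t ω) := by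
  rcases le_or_gt b 0 with hb | hb
  · filter_upwards [hM.nonneg] with ω hω h
    obtain ⟨t, ht⟩ := h.1.exists
    exact ((hω t).trans_lt (ht.trans (hab.trans_le hb))).false
  · have hr : ENNReal.ofReal a / ENNReal.ofReal b < 1 := by
      rw [ENNReal.div_lt_iff (by simp [hb]) (by simp), one_mul]
      exact (ENNReal.ofReal_lt_ofReal_iff hb).2 hab
    have h0 : P {ω | (∃ᶠ t in atTop, M t ω < a) ∧ ∃ᶠ t in atTop, b < M t ω} ≤ 0 :=
      ge_of_tendsto' (ENNReal.tendsto_pow_atTop_nhds_zero_of_lt_one hr) fun k ↦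
        (measure_mono fun ω hω ↦ upcrossTime_lt_top_of_frequently hω.1 hω.2 k).trans
          (hM.measure_upcrossTime_le hb k)
    exact measure_eq_zero_iff_ae_notMem.1 (le_antisymm h0 zero_le)

/-- The initial value need not be integrable, so the maximal inequality is applied on each event `M
0 ≤ n`, where passing `k` has probability at most `n / k`. -/
theorem IsNonnegLocalMartingale.ae_bddAbove [IsProbabilityMeasure P]
    [𝓕.IsRightContinuous] {M : ℝ≥0 → Ω → ℝ} (hM : IsNonnegLocalMartingale M 𝓕 P) :
    ∀ᵐ ω ∂P, ∃ C, ∀ t, M t ω ≤ C := by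
  have hrc := fun ω t ↦ (hM.cadlag ω t).1
  have h0 := isStoppingTime_const 𝓕 (0 : ℝ≥0)
  have hn : ∀ n : ℕ, P {ω | M 0 ω ≤ n ∧ ∀ k : ℕ, hitTime M (fun _ ↦ 0) (Set.Ioi k) ω < ⊤} = 0 := by
    intro n
    have hF : MeasurableSet[h0.measurableSpace] {ω | M 0 ω ≤ n} := by
      rw [IsStoppingTime.measurableSpace_const]
      exact (hM.adapted 0).measurable measurableSet_Iic
    have hlim : Tendsto (fun k : ℕ ↦ ENNReal.ofReal n / ENNReal.ofReal (k : ℝ)) atTop (𝓝 0) := by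
      simpa using ENNReal.Tendsto.const_div ENNReal.tendsto_nat_nhds_top
        (a := ENNReal.ofReal n) (by simp)
    refine le_antisymm (ge_of_tendsto hlim ?_) zero_le
    filter_upwards [eventually_gt_atTop 0] with k hk
    have hu := isStoppingTime_hitTime hM.adapted hrc h0 (isOpen_Ioi (a := (k : ℝ)))
    have h1 := hM.mul_measure_le h0 hu le_hitTime hF (a := n) (b := k)
      (fun ω hω _ ↦ hω)
      (fun ω _ h ↦ le_stoppedValue_hitTime_Ioi hrc h)
    rw [ENNReal.le_div_iff_mul_le (Or.inl (by simpa using hk.ne')) (Or.inl ENNReal.ofReal_ne_top),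
      mul_comm]
    calc _ ≤ _ := by
          gcongr
          exact fun ω hω ↦ ⟨hω.1, hω.2 k⟩
      _ ≤ _ := h1
      _ ≤ _ := mul_le_of_le_one_right zero_le prob_le_one
  have hall : ∀ᵐ ω ∂P, ∀ n : ℕ,
      ¬(M 0 ω ≤ n ∧ ∀ k : ℕ, hitTime M (fun _ ↦ 0) (Set.Ioi k) ω < ⊤) :=
    ae_all_iff.2 fun n ↦ measure_eq_zero_iff_ae_notMem.1 (hn n)
  filter_upwards [hall] with ω hω
  obtain ⟨n, hn⟩ := exists_nat_ge (M 0 ω)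
  have := hω n
  push Not at this
  obtain ⟨k, hk⟩ := this hn
  refine ⟨k, fun t ↦ ?_⟩
  simpa using notMem_of_lt_hitTime (M := M) (σ := fun _ ↦ 0) (S := Set.Ioi k) (ω := ω) (t := t)
    zero_le ((WithTop.coe_lt_top t).trans_le hk)

/-- A nonnegative local martingale converges almost surely. -/
theorem IsNonnegLocalMartingale.ae_tendsto_finalValue [IsProbabilityMeasure P]
    [𝓕.IsRightContinuous] {M : ℝ≥0 → Ω → ℝ} (hM : IsNonnegLocalMartingale M 𝓕 P) :
    ∀ᵐ ω ∂P, Tendsto (fun t ↦ M t ω) atTop (𝓝 (finalValue M ω)) := by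
  have hcross : ∀ᵐ ω ∂P, ∀ a b : ℚ, a < b →
      ¬((∃ᶠ t in atTop, M t ω < a) ∧ ∃ᶠ t in atTop, b < M t ω) := by
    simp only [ae_all_iff]
    exact fun a b hab ↦ hM.ae_not_frequently (by exact_mod_cast hab)
  filter_upwards [hcross, hM.ae_bddAbove, hM.nonneg] with ω h1 ⟨C, hC⟩ h0
  refine tendsto_nhds_limUnder (tendsto_of_no_upcrossings Rat.denseRange_cast ?_
    (isBoundedUnder_of ⟨C, hC⟩) (isBoundedUnder_of ⟨0, h0⟩))
  rintro _ ⟨a, rfl⟩ _ ⟨b, rfl⟩ hab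
  exact h1 a b (by exact_mod_cast hab)

/-! ### Agreement at the first passage over a high level -/

theorem coe_lt_globalMax_iff {M : ℝ≥0 → Ω → ℝ} {ω : Ω} {K : ℝ} :
    (K : EReal) < globalMax M ω ↔ hitTime M (fun _ ↦ 0) (Set.Ioi K) ω < ⊤ := by
  simp only [globalMax, lt_iSup_iff, hitTime_lt_iff, EReal.coe_lt_coe_iff]
  exact exists_congr fun t ↦ ⟨fun h ↦ ⟨zero_le, h, WithTop.coe_lt_top t⟩, fun h ↦ h.2.1⟩

/-- If `N` exceeds the level `K` whenever `M` does, then `N` has reached `K` by the time `M`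
exceeds it. -/
theorem IsNonnegLocalMartingale.ae_le_stoppedValue_hitTime [IsFiniteMeasure P]
    [𝓕.IsRightContinuous] {M N : ℝ≥0 → Ω → ℝ} (hM : IsNonnegLocalMartingale M 𝓕 P)
    (hN : IsNonnegLocalMartingale N 𝓕 P) {K : ℝ}
    (h : ∀ᵐ ω ∂P, hitTime M (fun _ ↦ 0) (Set.Ioi K) ω < ⊤ →
      hitTime N (fun _ ↦ 0) (Set.Ioi K) ω < ⊤) :
    ∀ᵐ ω ∂P, hitTime M (fun _ ↦ 0) (Set.Ioi K) ω < hitTime N (fun _ ↦ 0) (Set.Ioi K) ω →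
      K ≤ stoppedValue N (hitTime M (fun _ ↦ 0) (Set.Ioi K)) ω := by
  have hrcN := fun ω t ↦ (hN.cadlag ω t).1
  have h0 := isStoppingTime_const 𝓕 (0 : ℝ≥0)
  have hα := isStoppingTime_hitTime hM.adapted (fun ω t ↦ (hM.cadlag ω t).1) h0
    (isOpen_Ioi (a := K))
  have hβ := isStoppingTime_hitTime hN.adapted hrcN h0 (isOpen_Ioi (a := K))
  simp only [WithTop.coe_zero] at hα hβ
  set α := hitTime M (fun _ ↦ 0) (Set.Ioi K)
  set β := hitTime N (fun _ ↦ 0) (Set.Ioi K)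
  -- On `F` the value of `N` is at most `K` at `α` and at least `K` at `β`, while sampling bounds
  -- the integral at `β` by that at `α`. So `N` equals `K` at `α` almost everywhere on `F`, up to
  -- the truncation by `ENNReal.ofReal`.
  let F : Set Ω := {ω | β ω ≤ α ω}ᶜ
  have hF : MeasurableSet[(hβ.min hα).measurableSpace] F :=
    (hβ.measurableSet_stopping_time_le_min hα).compl
  have hFm : MeasurableSet F := (hβ.min hα).measurableSpace_le _ hF
  have hFlt : ∀ ω ∈ F, α ω < β ω := fun ω hω ↦ not_le.1 hω
  have hle := hN.setLIntegral_stoppedValue_le (hβ.min hα) hβ (fun ω ↦ min_le_left _ _) hF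
  have hFβ : (F ∩ {ω | β ω < ⊤} : Set Ω) =ᵐ[P] F := by
    filter_upwards [h] with ω hω
    exact propext ⟨fun hx ↦ hx.1, fun hx ↦ ⟨hx, hω ((hFlt ω hx).trans_le le_top)⟩⟩
  have hFσ : (F ∩ {ω | min (β ω) (α ω) < ⊤} : Set Ω) = F :=
    Set.inter_eq_left.2 fun ω hω ↦ (min_le_right _ _).trans_lt ((hFlt ω hω).trans_le le_top)
  have hσval : ∀ ω ∈ F, stoppedValue N (fun ω ↦ min (β ω) (α ω)) ω = stoppedValue N α ω := by
    intro ω hω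
    simp only [stoppedValue, min_eq_right (hFlt ω hω).le]
  have hNα : ∀ ω ∈ F, stoppedValue N α ω ≤ K := by
    intro ω hω
    have hαβ := hFlt ω hω
    obtain ⟨t, ht⟩ := WithTop.ne_top_iff_exists.1 (hαβ.trans_le le_top).ne
    have : stoppedValue N α ω = N t ω := by simp only [stoppedValue, ← ht]; rfl
    rw [this]
    simpa using notMem_of_lt_hitTime (M := N) (σ := fun _ ↦ 0) (S := Set.Ioi K) zero_le
      (ht ▸ hαβ)
  rw [setLIntegral_congr hFβ, hFσ, setLIntegral_congr_fun hFm
    (fun ω hω ↦ congrArg ENNReal.ofReal (hσval ω hω) : Set.EqOn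
      (fun ω ↦ ENNReal.ofReal (stoppedValue N (fun ω ↦ min (β ω) (α ω)) ω))
      (fun ω ↦ ENNReal.ofReal (stoppedValue N α ω)) F)] at hle
  have hfg : (fun ω ↦ ENNReal.ofReal (stoppedValue N α ω)) ≤ᵐ[P.restrict F]
      fun _ ↦ ENNReal.ofReal K :=
    (ae_restrict_mem hFm).mono fun ω hω ↦ ENNReal.ofReal_le_ofReal (hNα ω hω)
  have hKβ : ∫⁻ _ in F, ENNReal.ofReal K ∂P ≤
      ∫⁻ ω in F, ENNReal.ofReal (stoppedValue N β ω) ∂P := by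
    refine lintegral_mono_ae ?_
    filter_upwards [ae_restrict_mem hFm, ae_restrict_of_ae h] with ω hω hω'
    exact ENNReal.ofReal_le_ofReal
      (le_stoppedValue_hitTime_Ioi hrcN (hω' ((hFlt ω hω).trans_le le_top)))
  have hfin : ∫⁻ ω in F, ENNReal.ofReal (stoppedValue N α ω) ∂P ≠ ⊤ := by
    refine ne_top_of_le_ne_top ?_ (lintegral_mono_ae hfg)
    rw [setLIntegral_const]
    exact ENNReal.mul_ne_top ENNReal.ofReal_ne_top (measure_ne_top _ _)
  have heq := ae_eq_of_ae_le_of_lintegral_le hfg hfin aemeasurable_const (hKβ.trans hle)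
  filter_upwards [(ae_restrict_iff' hFm).1 heq, hN.nonneg] with ω hω h0 hlt
  exact (ENNReal.ofReal_le_ofReal_iff (h0 _)).1 (hω (not_le.2 hlt)).ge

/-- If two nonnegative local martingales exceed the same levels above `C`, then they agree at
the first time that one of them exceeds such a level. -/
theorem IsNonnegLocalMartingale.ae_stoppedValue_eq [IsFiniteMeasure P]
    [𝓕.IsRightContinuous] {M N : ℝ≥0 → Ω → ℝ} (hM : IsNonnegLocalMartingale M 𝓕 P)
    (hN : IsNonnegLocalMartingale N 𝓕 P) {C : ℝ}
    (h : ∀ᵐ ω ∂P, ∀ K : ℝ, C ≤ K → ((K : EReal) < globalMax M ω ↔ (K : EReal) < globalMax N ω))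
    {K : ℝ} (hK : C ≤ K) {σ : Ω → WithTop ℝ≥0}
    (hσ : σ = fun ω ↦ min (hitTime M (fun _ ↦ 0) (Set.Ioi K) ω)
      (hitTime N (fun _ ↦ 0) (Set.Ioi K) ω)) :
    ∀ᵐ ω ∂P, σ ω < ⊤ → stoppedValue M σ ω = stoppedValue N σ ω := by
  simp only [coe_lt_globalMax_iff] at h
  let α : ℝ → Ω → WithTop ℝ≥0 := fun L ↦ hitTime M (fun _ ↦ 0) (Set.Ioi L)
  let β : ℝ → Ω → WithTop ℝ≥0 := fun L ↦ hitTime N (fun _ ↦ 0) (Set.Ioi L)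
  -- The process that passes first is at least `L` by right-continuity, the other one by the
  -- preceding lemma.
  have hreach : ∀ L, C ≤ L → ∀ᵐ ω ∂P, min (α L ω) (β L ω) < ⊤ →
      L ≤ M (min (α L ω) (β L ω)).untopA ω ∧ L ≤ N (min (α L ω) (β L ω)).untopA ω := by
    intro L hL
    filter_upwards [hM.ae_le_stoppedValue_hitTime hN (h.mono fun ω hω ↦ (hω L hL).1),
      hN.ae_le_stoppedValue_hitTime hM (h.mono fun ω hω ↦ (hω L hL).2)] with ω h1 h2 hlt
    have hMα : α L ω < ⊤ → L ≤ M (α L ω).untopA ω :=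
      le_stoppedValue_hitTime_Ioi fun ω t ↦ (hM.cadlag ω t).1
    have hNβ : β L ω < ⊤ → L ≤ N (β L ω).untopA ω :=
      le_stoppedValue_hitTime_Ioi fun ω t ↦ (hN.cadlag ω t).1
    rcases lt_trichotomy (α L ω) (β L ω) with hab | hab | hab
    · rw [min_eq_left hab.le] at hlt ⊢
      exact ⟨hMα hlt, h1 hab⟩
    · rw [min_eq_left hab.le] at hlt ⊢
      exact ⟨hMα hlt, hab ▸ hNβ (hab ▸ hlt)⟩
    · rw [min_eq_right hab.le] at hlt ⊢
      exact ⟨h2 hab, hNβ hlt⟩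
  have hrat : ∀ᵐ ω ∂P, ∀ q : ℚ, C ≤ q → min (α q ω) (β q ω) < ⊤ →
      q ≤ M (min (α q ω) (β q ω)).untopA ω ∧ q ≤ N (min (α q ω) (β q ω)).untopA ω :=
    ae_all_iff.2 fun q ↦ eventually_imp_distrib_left.2 (hreach q)
  subst hσ
  filter_upwards [hrat, hreach K hK] with ω hq hKω hlt
  have hKω := hKω hlt
  change M (min (α K ω) (β K ω)).untopA ω = N (min (α K ω) (β K ω)).untopA ω
  obtain ⟨t, ht⟩ := WithTop.ne_top_iff_exists.1 hlt.ne
  change (t : WithTop ℝ≥0) = min (α K ω) (β K ω) at ht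
  rw [← ht] at hKω ⊢
  change K ≤ M t ω ∧ K ≤ N t ω at hKω
  change M t ω = N t ω
  have hmono : ∀ q : ℚ, K ≤ q → (t : WithTop ℝ≥0) ≤ min (α q ω) (β q ω) := fun q hq ↦ by
    rw [ht]
    exact min_le_min (hitTime_anti (Set.Ioi_subset_Ioi hq) ω)
      (hitTime_anti (Set.Ioi_subset_Ioi hq) ω)
  -- If one value at `t` is already above `q`, the first passage over `q` is also at `t`, so `hq`
  -- applies to both processes. No rational can then separate the two values.
  have hval : ∀ q : ℚ, K ≤ q → (q < M t ω ∨ q < N t ω) → q ≤ M t ω ∧ q ≤ N t ω := by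
    intro q hKq hlt
    have hle : min (α q ω) (β q ω) ≤ t := hlt.elim
      (fun hlt ↦ (min_le_left _ _).trans (hitTime_le_of_mem zero_le hlt))
      (fun hlt ↦ (min_le_right _ _).trans (hitTime_le_of_mem zero_le hlt))
    have heq := le_antisymm hle (hmono q hKq)
    have := hq q (hK.trans hKq)
    rw [heq] at this
    exact this (WithTop.coe_lt_top t)
  rcases lt_trichotomy (M t ω) (N t ω) with hlt | heq | hlt
  · obtain ⟨q, hq1, hq2⟩ := exists_rat_btwn hlt
    exact absurd (hval q (hKω.1.trans hq1.le) (Or.inr hq2)).1 (not_le.2 hq1)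
  · exact heq
  · obtain ⟨q, hq1, hq2⟩ := exists_rat_btwn hlt
    exact absurd (hval q (hKω.2.trans hq1.le) (Or.inl hq2)).2 (not_le.2 hq1)

/-! ### Agreement before a stopping time -/

/-- Two local martingales that stay at bounded distance before the stopping time `σ`, and agree
at `σ` (at infinity if `σ = ∞`), agree before `σ`. -/
theorem IsLocalMartingale.ae_eq_of_lt [IsFiniteMeasure P] {M N : ℝ≥0 → Ω → ℝ}
    (hM : IsLocalMartingale M 𝓕 P) (hN : IsLocalMartingale N 𝓕 P) {σ : Ω → WithTop ℝ≥0}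
    (hσ : IsStoppingTime 𝓕 σ) {K : ℝ}
    (hbdd : ∀ᵐ ω ∂P, ∀ t : ℝ≥0, t < σ ω → |M t ω - N t ω| ≤ K)
    (heq : ∀ᵐ ω ∂P, σ ω < ⊤ → stoppedValue M σ ω = stoppedValue N σ ω)
    (hlim : ∀ᵐ ω ∂P, Tendsto (fun t ↦ M t ω - N t ω) atTop (𝓝 0)) (s : ℝ≥0) :
    ∀ᵐ ω ∂P, s < σ ω → M s ω = N s ω := by
  classical
  obtain ⟨ρ, hρ, hmart⟩ := hM.locally_martingale
  obtain ⟨ρ', hρ', hmart'⟩ := hN.locally_martingale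
  -- A bounded time that reduces both processes at once and increases to `σ` in the limit.
  let κ : ℕ → Ω → WithTop ℝ≥0 := fun n ω ↦ min (min (σ ω) (n : ℝ≥0)) (min (ρ n ω) (ρ' n ω))
  have hκ : ∀ n, IsStoppingTime 𝓕 (κ n) := fun n ↦
    (hσ.min_const (n : ℝ≥0)).min ((hρ.isStoppingTime n).min (hρ'.isStoppingTime n))
  have hκσ : ∀ n ω, κ n ω ≤ σ ω := fun n ω ↦ (min_le_left _ _).trans (min_le_left _ _)
  have hκn : ∀ (n : ℕ) ω, κ n ω ≤ (n : ℝ≥0) := fun n ω ↦ (min_le_left _ _).trans (min_le_right _ _)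
  have hκρ : ∀ n ω, κ n ω ≤ ρ n ω := fun n ω ↦ (min_le_right _ _).trans (min_le_left _ _)
  have hκρ' : ∀ n ω, κ n ω ≤ ρ' n ω := fun n ω ↦ (min_le_right _ _).trans (min_le_right _ _)
  have hlarge : ∀ᵐ ω ∂P, ∀ t : ℝ≥0, ∀ᶠ n : ℕ in atTop,
      (t : WithTop ℝ≥0) < min ((n : ℝ≥0) : WithTop ℝ≥0) (min (ρ n ω) (ρ' n ω)) := by
    filter_upwards [hρ.tendsto_top, hρ'.tendsto_top] with ω h1 h2 t
    filter_upwards [eventually_lt_of_tendsto_top h1 t, eventually_lt_of_tendsto_top h2 t,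
      (tendsto_natCast_atTop_atTop (R := ℝ≥0)).eventually_gt_atTop t] with n hn1 hn2 hn3
    exact lt_min (WithTop.coe_lt_coe.2 hn3) (lt_min hn1 hn2)
  let D : ℝ≥0 → Ω → ℝ := fun t ω ↦ M t ω - N t ω
  let Dκ : ℕ → Ω → ℝ := fun n ω ↦ D (κ n ω).untopA ω
  -- The bound survives a jump at `σ`, since the difference is 0 there.
  have hDκ_bdd : ∀ᵐ ω ∂P, ∀ n, |Dκ n ω| ≤ |K| := by
    filter_upwards [hbdd, heq] with ω h1 h2 n
    obtain ⟨t, ht⟩ := WithTop.ne_top_iff_exists.1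
      ((hκn n ω).trans_lt (WithTop.coe_lt_top _)).ne
    rcases (hκσ n ω).lt_or_eq with hlt | he
    · have hD : Dκ n ω = M t ω - N t ω := by simp only [Dκ, D, ← ht]; rfl
      rw [hD]
      exact (h1 t (ht ▸ hlt)).trans (le_abs_self K)
    · have hD : Dκ n ω = stoppedValue M σ ω - stoppedValue N σ ω := by
        simp only [Dκ, D, he, stoppedValue]
      have hfin : σ ω < ⊤ := by rw [← he, ← ht]; exact WithTop.coe_lt_top t
      rw [hD, h2 hfin, sub_self, abs_zero]
      exact abs_nonneg K
  have hDκ_lim : ∀ᵐ ω ∂P, Tendsto (fun n ↦ Dκ n ω) atTop (𝓝 0) := by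
    filter_upwards [hlarge, heq, hlim] with ω h1 h2 h3
    by_cases hfin : σ ω < ⊤
    · obtain ⟨t, ht⟩ := WithTop.ne_top_iff_exists.1 hfin.ne
      refine tendsto_const_nhds.congr' ?_
      filter_upwards [h1 t] with n hn
      have he : κ n ω = σ ω := by
        simp only [κ, min_assoc, ← ht]
        exact min_eq_left hn.le
      have hD : Dκ n ω = stoppedValue M σ ω - stoppedValue N σ ω := by
        simp only [Dκ, D, he, stoppedValue]
      rw [hD, h2 hfin, sub_self]
    · have htop : σ ω = ⊤ := not_lt_top_iff.1 hfin
      refine h3.comp (tendsto_atTop.2 fun t ↦ ?_)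
      filter_upwards [h1 t] with n hn
      obtain ⟨r, hr⟩ := WithTop.ne_top_iff_exists.1
        ((hκn n ω).trans_lt (WithTop.coe_lt_top _)).ne
      have he : κ n ω = min ((n : ℝ≥0) : WithTop ℝ≥0) (min (ρ n ω) (ρ' n ω)) := by
        simp only [κ, min_assoc, htop]
        exact min_eq_right le_top
      rw [← he, ← hr] at hn
      rw [← hr]
      exact (WithTop.coe_lt_coe.1 hn).le
  have hs := isStoppingTime_const 𝓕 s
  have hσs : MeasurableSet[𝓕 s] {ω | s < σ ω} := hσ.measurableSet_gt s
  have hDm : StronglyMeasurable[𝓕 s] (D s) := (hM.adapted s).sub (hN.adapted s)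
  have hzero : ∀ F, MeasurableSet[𝓕 s] F → ∫ ω in F ∩ {ω | s < σ ω}, D s ω ∂P = 0 := by
    intro F hF
    -- The last condition follows from the one before it; it serves to place the set in the
    -- σ-algebra at `min s (κ n)`.
    let G : ℕ → Set Ω := fun n ↦ F ∩ {ω | κ n ω ≤ s}ᶜ ∩ {ω | s ≤ κ n ω}
    have hG1 : ∀ n, MeasurableSet[(hs.min (hκ n)).measurableSpace] (G n) := fun n ↦ by
      refine hs.measurableSet_inter_le (hκ n) _ ?_
      rw [IsStoppingTime.measurableSpace_const]
      exact hF.inter ((hκ n).measurableSet_le s).compl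
    have hG : ∀ n, MeasurableSet (G n) := fun n ↦ (hs.min (hκ n)).measurableSpace_le _ (hG1 n)
    have hGκ : ∀ n, ∀ ω ∈ G n, s < κ n ω := fun n ω hω ↦ not_le.1 hω.1.2
    have key : ∀ {L : ℝ≥0 → Ω → ℝ} {θ : ℕ → Ω → WithTop ℝ≥0}, HasCadlagPaths L →
        (∀ n, Martingale
          (stoppedProcess (fun i ↦ {ω | ⊥ < θ n ω}.indicator (L i)) (θ n)) 𝓕 P) →
        (∀ n ω, κ n ω ≤ θ n ω) → ∀ n, IntegrableOn (L s) (G n) P ∧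
          IntegrableOn (stoppedValue L (κ n)) (G n) P ∧
          ∫ ω in G n, L s ω ∂P = ∫ ω in G n, stoppedValue L (κ n) ω ∂P := by
      intro L θ hL hθ hκθ n
      have hκθ' : (fun ω ↦ min (κ n ω) (θ n ω)) = κ n := funext fun ω ↦ min_eq_left (hκθ n ω)
      have h1 := setIntegral_stoppedValue_of_reduced (fun ω t ↦ (hL ω t).1) (hθ n)
        (hs.min (hκ n)) (hκ n) (fun ω ↦ min_le_right _ _) (hκn n) (hG1 n)
        (fun ω hω ↦ bot_le.trans_lt ((hGκ n ω hω).trans_le (hκθ n ω)))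
      rw [hκθ'] at h1
      have hval : Set.EqOn (stoppedValue L fun ω ↦ min (min (s : WithTop ℝ≥0) (κ n ω)) (θ n ω))
          (L s) (G n) := fun ω hω ↦ by
        have : min (min (s : WithTop ℝ≥0) (κ n ω)) (θ n ω) = s := by
          rw [min_eq_left (hGκ n ω hω).le, min_eq_left ((hGκ n ω hω).le.trans (hκθ n ω))]
        simp only [stoppedValue, this]
        rfl
      refine ⟨h1.1.congr_fun hval (hG n), h1.2.1, ?_⟩
      rw [← setIntegral_congr_fun (hG n) hval]
      exact h1.2.2
    have hkM := key hM.cadlag hmart hκρ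
    have hkN := key hN.cadlag hmart' hκρ'
    -- `M` and `N` are sampled separately, being integrable on `G n`; only their difference is
    -- dominated uniformly in `n`, which lets `n` tend to infinity.
    have hint : ∀ n, ∫ ω, (G n).indicator (D s) ω ∂P = ∫ ω, (G n).indicator (Dκ n) ω ∂P := by
      intro n
      obtain ⟨a1, a2, a3⟩ := hkM n
      obtain ⟨b1, b2, b3⟩ := hkN n
      rw [integral_indicator (hG n), integral_indicator (hG n)]
      exact (integral_sub a1 b1).trans ((congrArg₂ _ a3 b3).trans (integral_sub a2 b2).symm)
    have hlim1 : Tendsto (fun n ↦ ∫ ω, (G n).indicator (D s) ω ∂P) atTop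
        (𝓝 (∫ ω, (F ∩ {ω | s < σ ω}).indicator (D s) ω ∂P)) := by
      refine tendsto_integral_of_dominated_convergence (fun _ ↦ |K|) (fun n ↦ ?_)
        (integrable_const _) (fun n ↦ ?_) ?_
      · exact ((hDm.mono (𝓕.le s)).indicator (hG n)).aestronglyMeasurable
      · filter_upwards [hbdd] with ω hω
        rw [Set.indicator_apply]
        split_ifs with hωG
        · exact (hω s ((hGκ n ω hωG).trans_le (hκσ n ω))).trans (le_abs_self K)
        · simp
      · filter_upwards [hlarge] with ω hω
        refine tendsto_const_nhds.congr' ?_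
        filter_upwards [hω s] with n hn
        have hiff : ω ∈ F ∩ {ω | s < σ ω} ↔ ω ∈ G n := by
          constructor
          · rintro ⟨h1, h2⟩
            have h3 : s < κ n ω := by
              simp only [κ, min_assoc]
              exact lt_min h2 hn
            exact ⟨⟨h1, not_le.2 h3⟩, h3.le⟩
          · exact fun h ↦ ⟨h.1.1, (hGκ n ω h).trans_le (hκσ n ω)⟩
        simp only [Set.indicator_apply, hiff]
    have hlim2 : Tendsto (fun n ↦ ∫ ω, (G n).indicator (Dκ n) ω ∂P) atTop (𝓝 0) := by
      rw [← integral_zero Ω ℝ (μ := P)]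
      refine tendsto_integral_of_dominated_convergence (fun _ ↦ |K|) (fun n ↦ ?_)
        (integrable_const _) (fun n ↦ ?_) ?_
      · exact (aestronglyMeasurable_indicator_iff (hG n)).2
          ((hkM n).2.1.sub (hkN n).2.1).aestronglyMeasurable
      · filter_upwards [hDκ_bdd] with ω hω
        exact (norm_indicator_le_norm_self _ _).trans (hω n)
      · filter_upwards [hDκ_lim] with ω hω
        exact squeeze_zero_norm (fun n ↦ norm_indicator_le_norm_self _ _)
          (tendsto_zero_iff_norm_tendsto_zero.1 hω)
    simp_rw [hint] at hlim1
    rw [← integral_indicator ((𝓕.le s _ hF).inter (𝓕.le s _ hσs))]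
    exact tendsto_nhds_unique hlim1 hlim2
  have hfi : Integrable ({ω | s < σ ω}.indicator (D s)) P := by
    refine Integrable.of_bound (C := |K|)
      ((hDm.mono (𝓕.le s)).indicator (𝓕.le s _ hσs)).aestronglyMeasurable ?_
    filter_upwards [hbdd] with ω hω
    rw [Set.indicator_apply]
    split_ifs with h
    · exact (hω s h).trans (le_abs_self K)
    · simp
  have hae : {ω | s < σ ω}.indicator (D s) =ᵐ[P] 0 := by
    refine ae_eq_of_forall_setIntegral_eq_of_sigmaFinite' (𝓕.le s)
      (fun F _ _ ↦ hfi.integrableOn) (fun F _ _ ↦ integrableOn_zero) (fun F hF _ ↦ ?_)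
      (hDm.indicator hσs).aestronglyMeasurable stronglyMeasurable_zero.aestronglyMeasurable
    rw [setIntegral_indicator (𝓕.le s _ hσs), hzero F hF]
    simp
  filter_upwards [hae] with ω hω hsσ
  rw [Set.indicator_of_mem (s := {ω | s < σ ω}) hsσ] at hω
  exact sub_eq_zero.1 hω

/-! ### Indistinguishability and reconstruction -/

/-- Right-continuous processes that agree almost surely at each time are indistinguishable. -/
theorem ae_forall_eq_of_rightContinuous {M N : ℝ≥0 → Ω → ℝ}
    (hM : ∀ ω t, ContinuousWithinAt (fun s ↦ M s ω) (Set.Ici t) t)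
    (hN : ∀ ω t, ContinuousWithinAt (fun s ↦ N s ω) (Set.Ici t) t)
    (h : ∀ s, ∀ᵐ ω ∂P, M s ω = N s ω) : ∀ᵐ ω ∂P, ∀ t, M t ω = N t ω := by
  filter_upwards [ae_all_iff.2 fun n ↦ h (TopologicalSpace.denseSeq ℝ≥0 n)] with ω hω t
  have hfreq : ∃ᶠ s in 𝓝[≥] t, M s ω - N s ω ∈ ({0} : Set ℝ) := by
    refine (nhdsGE_basis t).frequently_iff.2 fun b hb ↦ ?_
    obtain ⟨n, hn⟩ := (TopologicalSpace.denseRange_denseSeq ℝ≥0).exists_mem_open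
      isOpen_Ioo (Set.nonempty_Ioo.2 hb)
    exact ⟨_, ⟨hn.1.le, hn.2⟩, sub_eq_zero.2 (hω n)⟩
  have := mem_closure_of_frequently_of_tendsto hfreq ((hM ω t).sub (hN ω t)).tendsto
  simpa [sub_eq_zero] using this

/-- A nonnegative local martingale is determined by its final value and the excursions of its
global maximum above any fixed level. -/
theorem IsNonnegLocalMartingale.ae_eq_of_finalValue_eq [IsProbabilityMeasure P]
    [𝓕.IsRightContinuous] {M N : ℝ≥0 → Ω → ℝ} (hM : IsNonnegLocalMartingale M 𝓕 P)
    (hN : IsNonnegLocalMartingale N 𝓕 P) (hfin : finalValue M =ᵐ[P] finalValue N) {C : ℝ}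
    (hmax : ∀ᵐ ω ∂P, ∀ K : ℝ, C ≤ K →
      ((K : EReal) < globalMax M ω ↔ (K : EReal) < globalMax N ω)) :
    ∀ᵐ ω ∂P, ∀ t, M t ω = N t ω := by
  have hrcM := fun ω t ↦ (hM.cadlag ω t).1
  have hrcN := fun ω t ↦ (hN.cadlag ω t).1
  refine ae_forall_eq_of_rightContinuous hrcM hrcN fun s ↦ ?_
  have h0 := isStoppingTime_const 𝓕 (0 : ℝ≥0)
  have hlim : ∀ᵐ ω ∂P, Tendsto (fun t ↦ M t ω - N t ω) atTop (𝓝 0) := by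
    filter_upwards [hM.ae_tendsto_finalValue, hN.ae_tendsto_finalValue, hfin] with ω h1 h2 h3
    rw [← sub_self (finalValue N ω)]
    nth_rewrite 1 [← h3]
    exact h1.sub h2
  have hk : ∀ k : ℕ, C ≤ k → ∀ᵐ ω ∂P,
      s < min (hitTime M (fun _ ↦ 0) (Set.Ioi k) ω) (hitTime N (fun _ ↦ 0) (Set.Ioi k) ω) →
        M s ω = N s ω := by
    intro k hCk
    have hσ := (isStoppingTime_hitTime hM.adapted hrcM h0 (isOpen_Ioi (a := (k : ℝ)))).min
      (isStoppingTime_hitTime hN.adapted hrcN h0 (isOpen_Ioi (a := (k : ℝ))))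
    refine hM.toIsLocalMartingale.ae_eq_of_lt hN.toIsLocalMartingale (K := k) hσ ?_
      (hM.ae_stoppedValue_eq hN hmax hCk rfl) hlim s
    filter_upwards [hM.nonneg, hN.nonneg] with ω hM0 hN0 t ht
    have h1 : M t ω ≤ k := not_lt.1
      (notMem_of_lt_hitTime (S := Set.Ioi (k : ℝ)) zero_le (ht.trans_le (min_le_left _ _)))
    have h2 : N t ω ≤ k := not_lt.1
      (notMem_of_lt_hitTime (S := Set.Ioi (k : ℝ)) zero_le (ht.trans_le (min_le_right _ _)))
    exact abs_le.2 ⟨by linarith [hM0 t], by linarith [hN0 t]⟩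
  -- For `k` above bounds for both paths neither passes `k`, so the stopping time is infinite and
  -- `s` lies before it.
  filter_upwards [ae_all_iff.2 fun k : ℕ ↦ eventually_imp_distrib_left.2 (hk k),
    hM.ae_bddAbove, hN.ae_bddAbove] with ω hω ⟨A, hA⟩ ⟨B, hB⟩
  obtain ⟨k, hkmax⟩ := exists_nat_ge (max C (max A B))
  have hCk : C ≤ k := (le_max_left _ _).trans hkmax
  have hAk : A ≤ k := (le_max_left _ _).trans ((le_max_right _ _).trans hkmax)
  have hBk : B ≤ k := (le_max_right _ _).trans ((le_max_right _ _).trans hkmax)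
  have htop : ∀ {L : ℝ≥0 → Ω → ℝ}, (∀ t, L t ω ≤ k) →
      hitTime L (fun _ ↦ 0) (Set.Ioi k) ω = ⊤ := fun hL ↦ not_lt_top_iff.1 fun hlt ↦ by
    obtain ⟨t, -, ht, -⟩ := hitTime_lt_iff.1 hlt
    exact (hL t).not_gt ht
  refine hω k hCk ?_
  rw [htop fun t ↦ (hA t).trans hAk, htop fun t ↦ (hB t).trans hBk, min_self]
  exact WithTop.coe_lt_top s

/-- Bounded variables cannot affect whether high levels are exceeded. `X` and `Y` may differ because
a process chosen to fit the data comes with its own bounded variable. -/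
theorem IsNonnegLocalMartingale.ae_eq_of_max_globalMax_eq [IsProbabilityMeasure P]
    [𝓕.IsRightContinuous] {M N : ℝ≥0 → Ω → ℝ} (hM : IsNonnegLocalMartingale M 𝓕 P)
    (hN : IsNonnegLocalMartingale N 𝓕 P) (hfin : finalValue M =ᵐ[P] finalValue N) {X Y : Ω → ℝ}
    (hX : ∃ C : ℝ, ∀ᵐ ω ∂P, |X ω| ≤ C) (hY : ∃ C : ℝ, ∀ᵐ ω ∂P, |Y ω| ≤ C)
    (hmax : (fun ω ↦ max (X ω : EReal) (globalMax M ω)) =ᵐ[P]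
      fun ω ↦ max (Y ω : EReal) (globalMax N ω)) :
    ∀ᵐ ω ∂P, ∀ t, M t ω = N t ω := by
  obtain ⟨A, hA⟩ := hX
  obtain ⟨B, hB⟩ := hY
  refine hM.ae_eq_of_finalValue_eq hN hfin (C := max A B) ?_
  filter_upwards [hA, hB, hmax] with ω hAω hBω hω K hK
  have hXK : ¬(K : EReal) < X ω := not_lt.2 <| EReal.coe_le_coe_iff.2 <|
    (le_abs_self _).trans (hAω.trans ((le_max_left _ _).trans hK))
  have hYK : ¬(K : EReal) < Y ω := not_lt.2 <| EReal.coe_le_coe_iff.2 <|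
    (le_abs_self _).trans (hBω.trans ((le_max_right _ _).trans hK))
  have h1 : (K : EReal) < max (X ω : EReal) (globalMax M ω) ↔ (K : EReal) < globalMax M ω := by
    rw [lt_max_iff, or_iff_right hXK]
  have h2 : (K : EReal) < max (Y ω : EReal) (globalMax N ω) ↔ (K : EReal) < globalMax N ω := by
    rw [lt_max_iff, or_iff_right hYK]
  rw [← h1, ← h2, hω]

end

theorem propositionP {Ω : Type*} {mΩ : MeasurableSpace Ω} (P : Measure Ω)
    [IsProbabilityMeasure P] (𝓕 : Filtration ℝ≥0 mΩ) [𝓕.IsRightContinuous] :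
    -- the final value exists
    (∀ M : ℝ≥0 → Ω → ℝ, IsNonnegLocalMartingale M 𝓕 P →
      ∀ᵐ ω ∂P, Tendsto (fun t ↦ M t ω) atTop (𝓝 (finalValue M ω))) ∧
    -- one map recovers every `M` from any version of the pair, for every bounded `X`
    (∃ Φ : (Ω → ℝ) → (Ω → EReal) → ℝ≥0 → Ω → ℝ,
      ∀ (M : ℝ≥0 → Ω → ℝ) (X : Ω → ℝ), IsNonnegLocalMartingale M 𝓕 P → Measurable X →
        (∃ C : ℝ, ∀ᵐ ω ∂P, |X ω| ≤ C) →
        ∀ (ξ : Ω → ℝ) (η : Ω → EReal), ξ =ᵐ[P] finalValue M →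
          η =ᵐ[P] (fun ω ↦ max (X ω : EReal) (globalMax M ω)) →
          ∀ᵐ ω ∂P, ∀ t, Φ ξ η t ω = M t ω) ∧
    -- in particular, final value and global maximum determine `M`
    (∀ M N : ℝ≥0 → Ω → ℝ, IsNonnegLocalMartingale M 𝓕 P → IsNonnegLocalMartingale N 𝓕 P →
      finalValue M =ᵐ[P] finalValue N → globalMax M =ᵐ[P] globalMax N →
      ∀ᵐ ω ∂P, ∀ t, M t ω = N t ω) := by
  refine ⟨fun M hM ↦ hM.ae_tendsto_finalValue, ?_, fun M N hM hN hfin hmax ↦ ?_⟩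
  · -- `Φ ξ η` is the local martingale, unique up to null sets, that is compatible with `(ξ, η)`
    classical
    let Q : (Ω → ℝ) → (Ω → EReal) → (ℝ≥0 → Ω → ℝ) → Prop := fun ξ η N ↦
      IsNonnegLocalMartingale N 𝓕 P ∧ ∃ Y : Ω → ℝ, (∃ C : ℝ, ∀ᵐ ω ∂P, |Y ω| ≤ C) ∧
        ξ =ᵐ[P] finalValue N ∧ η =ᵐ[P] fun ω ↦ max (Y ω : EReal) (globalMax N ω)
    refine ⟨fun ξ η ↦ if h : ∃ N, Q ξ η N then h.choose else 0,
      fun M X hM _ hX ξ η hξ hη ↦ ?_⟩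
    have hex : ∃ N, Q ξ η N := ⟨M, hM, X, hX, hξ, hη⟩
    obtain ⟨hN, Y, hY, hξN, hηN⟩ := hex.choose_spec
    simp only [dif_pos hex]
    exact hN.ae_eq_of_max_globalMax_eq hM (hξN.symm.trans hξ) hY hX (hηN.symm.trans hη)
  · refine hM.ae_eq_of_max_globalMax_eq hN hfin (X := 0) (Y := 0) ⟨0, by simp⟩ ⟨0, by simp⟩ ?_
    filter_upwards [hmax] with ω hω
    rw [hω]
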